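/- For $t\in\mathbb{R}$ let $\mathcal{D}_t$ be the Hilbert space of holomorphic functions $f(z)=\sum_{n=1}^\infty a_nz^n$ on the open unit disc $\mathbb{D}$ with $\|f\|_t^2=\sum_{n=1}^\infty|a_n|^2(n+1)^t<\infty$ (with the corresponding inner product); in particular $\mathcal{D}_0=H_0^2(\mathbb{D})$ is the Hardy space of functions vanishing at $0$. A sequence $\{x_k\}_{k\ge1}$ in a Hilbert space $H$ is a frame for $H$ if there are constants $A,B>0$ with $A\|x\|^2\le\sum_{k=1}^\infty|\langle x,x_k\rangle|^2\le B\|x\|^2$ for all $x\in H$, and a Riesz basis for $H$ if there is an invertible bounded operator $T$ on $H$ such that $\{Tx_k\}_{k\ge1}$ is an orthonormal basis for $H$. Let $\mathbb{T}^\infty$ be the product of countably many unit circles with its normalized Haar measure $\rho$, let $H^2(\mathbb{T}^\infty)$ be the closed linear span in $L^2(\mathbb{T}^\infty,\rho)$ of the monomials $\zeta^\alpha$ ($\alpha$ a finitely supported sequence of non-negative integers), and let $H^\infty(\mathbb{T}^\infty)$ be the algebra of (essentially) bounded functions in $H^2(\mathbb{T}^\infty)$ under the pointwise product. For a positive integer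 $n=p_1^{\alpha_1}\cdots p_m^{\alpha_m}$, where $p_j$ is the $j$-th prime, write $\zeta^{\alpha(n)}=\zeta_1^{\alpha_1}\cdots\zeta_m^{\alpha_m}$. The Bohr transform $\mathcal{B}:H_0^2(\mathbb{D})\to H^2(\mathbb{T}^\infty)$ is $\mathcal{B}\big(\sum_{n=1}^\infty a_nz^n\big)=\sum_{n=1}^\infty a_n\zeta^{\alpha(n)}$. Theorem. Suppose $t\in\mathbb{R}$ and $f\in\mathcal{D}_t$. (1) If $t=0$, then the following are equivalent: $\{f(z^k)\}_{k\ge1}$ is a frame for $H_0^2(\mathbb{D})$; $\{f(z^k)\}_{k\ge1}$ is a Riesz basis for $H_0^2(\mathbb{D})$; $\mathcal{B}f$ is invertible in the algebra $H^\infty(\mathbb{T}^\infty)$. (2) If $t\neq0$, then $\{f(z^k)\}_{k\ge1}$ is not a frame for $\mathcal{D}_t$. -/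

import Mathlib

open MeasureTheory
open scoped Complex.UnitDisc ComplexConjugate

noncomputable section

/-! ### Frames and Riesz bases of an inner product space -/

section Bases

variable {H : Type*} [NormedAddCommGroup H] [InnerProductSpace ℂ H]

/-- A sequence `x₁, x₂, …` is a frame for `H` if `A ‖h‖² ≤ ∑ₖ |⟨h, xₖ⟩|² ≤ B ‖h‖²` for all `h`, with
constants `A, B > 0`. -/
def IsFrame (x : ℕ+ → H) : Prop :=
  ∃ A B : ℝ, 0 < A ∧ 0 < B ∧ ∀ h : H,
    Summable (fun k => ‖inner ℂ (x k) h‖ ^ 2) ∧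
      A * ‖h‖ ^ 2 ≤ ∑' k, ‖inner ℂ (x k) h‖ ^ 2 ∧
      ∑' k, ‖inner ℂ (x k) h‖ ^ 2 ≤ B * ‖h‖ ^ 2

/-- A sequence `x₁, x₂, …` is a Riesz basis for `H` if some bounded invertible operator `T` on `H`
maps it to an orthonormal (Hilbert) basis of `H`. -/
def IsRieszBasis (x : ℕ+ → H) : Prop :=
  ∃ (T : H ≃L[ℂ] H) (b : HilbertBasis ℕ+ ℂ H), ∀ k, T (x k) = b k

end Bases

/-! ### The Dirichlet-type spaces -/

/-- A power series without constant term that vanishes on the unit disc has zero coefficients. -/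
theorem powerSeries_coeff_eq_zero {c : ℕ+ → ℂ}
    (h : ∀ z : 𝔻, HasSum (fun n : ℕ+ => c n * (z : ℂ) ^ (n : ℕ)) 0) : c = 0 := by
  set c' : ℕ → ℂ := fun n => if hn : 0 < n then c ⟨n, hn⟩ else 0 with hc'
  have hc'n : ∀ n : ℕ+, c' n = c n := fun n => by
    simp only [hc', n.pos, dif_pos]; rfl
  have key : HasFPowerSeriesAt (fun _ : ℂ => (0 : ℂ)) (FormalMultilinearSeries.ofScalars ℂ c') 0 := by
    rw [hasFPowerSeriesAt_iff]
    filter_upwards [Metric.ball_mem_nhds (0 : ℂ) one_pos] with z hz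
    have hz' : ‖z‖ < 1 := by simpa using hz
    have := h (Complex.UnitDisc.mk z hz')
    rw [← (PNat.coe_injective).hasSum_iff]
    · have he : ((fun n : ℕ => z ^ n • (FormalMultilinearSeries.ofScalars ℂ c').coeff n) ∘
          PNat.val) = fun n : ℕ+ => c n * z ^ (n : ℕ) := by
        funext n
        have := hc'n n
        simp only [Function.comp, FormalMultilinearSeries.coeff_ofScalars, smul_eq_mul]
        rw [mul_comm, ← this]
      rw [he]
      exact this
    · intro n hn
      have : n = 0 := by
        by_contra hne
        exact hn ⟨⟨n, Nat.pos_of_ne_zero hne⟩, rfl⟩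
      subst this
      simp [hc']
  have h0 := key.eq_zero
  funext n
  have h1 : (FormalMultilinearSeries.ofScalars ℂ c').coeff (n : ℕ) = 0 := by
    rw [h0]; rfl
  rw [FormalMultilinearSeries.coeff_ofScalars] at h1
  exact (hc'n n).symm.trans h1

theorem summable_weighted_add {w : ℕ+ → ℝ} (hw : ∀ n, 0 ≤ w n) {a b : ℕ+ → ℂ}
    (ha : Summable fun n => ‖a n‖ ^ 2 * w n) (hb : Summable fun n => ‖b n‖ ^ 2 * w n) :
    Summable fun n => ‖a n + b n‖ ^ 2 * w n := by
  refine Summable.of_nonneg_of_le (fun n => mul_nonneg (sq_nonneg _) (hw n)) (fun n => ?_)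
    ((ha.mul_left 2).add (hb.mul_left 2))
  have h1 : ‖a n + b n‖ ^ 2 ≤ 2 * ‖a n‖ ^ 2 + 2 * ‖b n‖ ^ 2 := by
    have := norm_add_le (a n) (b n)
    nlinarith [norm_nonneg (a n + b n), sq_nonneg (‖a n‖ - ‖b n‖)]
  nlinarith [hw n]

theorem weight_pos (t : ℝ) (n : ℕ+) : 0 < ((n : ℝ) + 1) ^ t := by positivity

/-- The vector space of all functions `f(z) = ∑_{n ≥ 1} aₙ zⁿ` on the open unit disc `𝔻` (the series
converging at every point of `𝔻`, so that `f` is holomorphic) with `∑ |aₙ|² (n + 1)ᵗ < ∞`. -/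
def dirichletSubmodule (t : ℝ) : Submodule ℂ (𝔻 → ℂ) where
  carrier := {f | ∃ a : ℕ+ → ℂ,
    (∀ z : 𝔻, HasSum (fun n : ℕ+ => a n * (z : ℂ) ^ (n : ℕ)) (f z)) ∧
      Summable fun n : ℕ+ => ‖a n‖ ^ 2 * ((n : ℝ) + 1) ^ t}
  zero_mem' := ⟨0, fun z => by simp, by simp⟩
  add_mem' := by
    rintro f g ⟨a, ha, ha'⟩ ⟨b, hb, hb'⟩
    refine ⟨fun n => a n + b n, fun z => ?_,
      summable_weighted_add (fun n => (weight_pos t n).le) ha' hb'⟩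
    simpa [add_mul] using (ha z).add (hb z)
  smul_mem' := by
    rintro c f ⟨a, ha, ha'⟩
    refine ⟨fun n => c * a n, fun z => ?_, ?_⟩
    · simpa [mul_assoc] using (ha z).mul_left c
    · simpa [mul_pow, mul_assoc] using ha'.mul_left (‖c‖ ^ 2)

/-- The Dirichlet-type space `𝒟ₜ`. It is a type of its own, so that its topology comes from the norm
defined below and not from pointwise convergence. -/
def DirichletType (t : ℝ) : Type := dirichletSubmodule t

namespace DirichletType

variable {t : ℝ}

instance : AddCommGroup (DirichletType t) := inferInstanceAs (AddCommGroup (dirichletSubmodule t))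

instance : Module ℂ (DirichletType t) := inferInstanceAs (Module ℂ (dirichletSubmodule t))

instance : CoeFun (DirichletType t) fun _ => 𝔻 → ℂ := ⟨fun f => f.1⟩

/-- The coefficients `aₙ`, `n ≥ 1`, of `f(z) = ∑ aₙ zⁿ`. -/
def coeff (f : DirichletType t) : ℕ+ → ℂ := f.2.choose

theorem hasSum_coeff (f : DirichletType t) (z : 𝔻) :
    HasSum (fun n : ℕ+ => f.coeff n * (z : ℂ) ^ (n : ℕ)) (f z) := f.2.choose_spec.1 z

theorem summable_coeff (f : DirichletType t) :
    Summable fun n : ℕ+ => ‖f.coeff n‖ ^ 2 * ((n : ℝ) + 1) ^ t := f.2.choose_spec.2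

theorem coeff_unique (f : DirichletType t) {a : ℕ+ → ℂ}
    (ha : ∀ z : 𝔻, HasSum (fun n : ℕ+ => a n * (z : ℂ) ^ (n : ℕ)) (f z)) : f.coeff = a := by
  have := powerSeries_coeff_eq_zero (c := fun n => f.coeff n - a n) fun z => by
    simpa [sub_mul] using (f.hasSum_coeff z).sub (ha z)
  funext n
  exact sub_eq_zero.1 (congrFun this n)

theorem coeff_add (f g : DirichletType t) (n : ℕ+) : (f + g).coeff n = f.coeff n + g.coeff n := by
  refine congrFun ((f + g).coeff_unique (a := fun n => f.coeff n + g.coeff n) fun z => ?_) n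
  simp only [add_mul]
  exact (f.hasSum_coeff z).add (g.hasSum_coeff z)

theorem coeff_smul (c : ℂ) (f : DirichletType t) (n : ℕ+) : (c • f).coeff n = c * f.coeff n := by
  refine congrFun ((c • f).coeff_unique (a := fun n => c * f.coeff n) fun z => ?_) n
  simp only [mul_assoc]
  exact (f.hasSum_coeff z).mul_left c

theorem eq_zero_of_coeff {f : DirichletType t} (h : ∀ n, f.coeff n = 0) : f = 0 := by
  refine Subtype.ext (funext fun z => ?_)
  have := f.hasSum_coeff z
  simp only [h, zero_mul] at this
  exact this.unique hasSum_zero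

theorem summable_inner (f g : DirichletType t) :
    Summable fun n : ℕ+ => conj (f.coeff n) * g.coeff n * (((n : ℝ) + 1) ^ t : ℝ) := by
  refine Summable.of_norm_bounded (f.summable_coeff.add g.summable_coeff) fun n => ?_
  have hw := weight_pos t n
  rw [norm_mul, norm_mul, Complex.norm_real, Real.norm_of_nonneg hw.le, RCLike.norm_conj, ← add_mul]
  refine mul_le_mul_of_nonneg_right ?_ hw.le
  nlinarith [sq_nonneg (‖f.coeff n‖ - ‖g.coeff n‖), sq_nonneg ‖f.coeff n‖, sq_nonneg ‖g.coeff n‖]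

/-- The inner product `∑ₙ conj(aₙ) bₙ (n + 1)ᵗ` of `f = ∑ aₙ zⁿ` and `g = ∑ bₙ zⁿ` (conjugate-linear
in the first argument, as is customary in Mathlib). -/
def innerSeries (f g : DirichletType t) : ℂ :=
  ∑' n : ℕ+, conj (f.coeff n) * g.coeff n * (((n : ℝ) + 1) ^ t : ℝ)

theorem innerSeries_self (f : DirichletType t) :
    f.innerSeries f = ((∑' n : ℕ+, ‖f.coeff n‖ ^ 2 * ((n : ℝ) + 1) ^ t : ℝ) : ℂ) := by
  rw [innerSeries, Complex.ofReal_tsum]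
  refine tsum_congr fun n => ?_
  rw [Complex.conj_mul']
  push_cast
  rfl

/-- `innerSeries` is a positive definite inner product. -/
abbrev core : InnerProductSpace.Core ℂ (DirichletType t) where
  inner f g := innerSeries f g
  conj_inner_symm f g := by
    simp only [innerSeries, Complex.conj_tsum, map_mul, Complex.conj_conj, Complex.conj_ofReal]
    exact tsum_congr fun n => by ring
  re_inner_nonneg f := by
    rw [innerSeries_self]
    exact tsum_nonneg fun n => mul_nonneg (sq_nonneg _) (weight_pos t n).le
  add_left f g h := by
    simp only [innerSeries]
    rw [← (summable_inner f h).tsum_add (summable_inner g h)]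
    exact tsum_congr fun n => by rw [coeff_add, map_add]; ring
  smul_left f g c := by
    simp only [innerSeries]
    rw [← tsum_mul_left]
    exact tsum_congr fun n => by rw [coeff_smul, map_mul]; ring
  definite f h := by
    refine eq_zero_of_coeff fun n => ?_
    have h' : (∑' n : ℕ+, ‖f.coeff n‖ ^ 2 * ((n : ℝ) + 1) ^ t) = 0 := by
      have := (innerSeries_self f).symm.trans h
      exact_mod_cast this
    have h0 := (hasSum_zero_iff_of_nonneg
      (fun n => mul_nonneg (sq_nonneg ‖f.coeff n‖) (weight_pos t n).le)).1
      (h' ▸ f.summable_coeff.hasSum)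
    simpa [(weight_pos t n).ne'] using congrFun h0 n

instance : NormedAddCommGroup (DirichletType t) :=
  @InnerProductSpace.Core.toNormedAddCommGroup ℂ _ _ _ _ core

instance : InnerProductSpace ℂ (DirichletType t) := InnerProductSpace.ofCore core.toCore

theorem norm_sq (f : DirichletType t) :
    ‖f‖ ^ 2 = ∑' n : ℕ+, ‖f.coeff n‖ ^ 2 * ((n : ℝ) + 1) ^ t := by
  have h : inner ℂ f f = ((‖f‖ ^ 2 : ℝ) : ℂ) := by
    rw [inner_self_eq_norm_sq_to_K]; norm_cast
  have h' : inner ℂ f f = f.innerSeries f := rfl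
  rw [h', innerSeries_self] at h
  exact_mod_cast h.symm

theorem weight_mul_le (t : ℝ) (k n : ℕ+) :
    (((n * k : ℕ+) : ℝ) + 1) ^ t ≤ max 1 ((k : ℝ) ^ t) * ((n : ℝ) + 1) ^ t := by
  have hk : (1 : ℝ) ≤ k := by exact_mod_cast k.2
  have hn : (1 : ℝ) ≤ n := by exact_mod_cast n.2
  push_cast
  rcases le_or_gt 0 t with ht | ht
  · calc ((n : ℝ) * k + 1) ^ t ≤ ((k : ℝ) * (n + 1)) ^ t := by gcongr; nlinarith
      _ = (k : ℝ) ^ t * ((n : ℝ) + 1) ^ t := Real.mul_rpow (by positivity) (by positivity)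
      _ ≤ _ := by gcongr; exact le_max_right _ _
  · calc ((n : ℝ) * k + 1) ^ t ≤ ((n : ℝ) + 1) ^ t :=
          Real.rpow_le_rpow_of_nonpos (by positivity) (by nlinarith) ht.le
      _ = 1 * ((n : ℝ) + 1) ^ t := (one_mul _).symm
      _ ≤ _ := by gcongr; exact le_max_left _ _

theorem comp_pow_mem (f : DirichletType t) (k : ℕ+) :
    (fun z : 𝔻 => f (z ^ k)) ∈ dirichletSubmodule t := by
  have hinj : Function.Injective fun n : ℕ+ => n * k := fun a b h => mul_right_cancel h
  set b : ℕ+ → ℂ := Function.extend (fun n : ℕ+ => n * k) f.coeff 0 with hb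
  have hbk : ∀ n, b (n * k) = f.coeff n := fun n => hinj.extend_apply f.coeff 0 n
  have hb0 : ∀ m, m ∉ Set.range (fun n : ℕ+ => n * k) → b m = 0 := fun m hm => by
    rw [hb, Function.extend_apply' _ _ _ (by simpa using hm)]; rfl
  refine ⟨b, fun z => ?_, ?_⟩
  · rw [← hinj.hasSum_iff (fun m hm => by simp [hb0 m hm])]
    convert f.hasSum_coeff (z ^ k) using 2 with n
    simp only [Function.comp, hbk, Complex.UnitDisc.coe_pow, ← pow_mul]
    rw [PNat.mul_coe, mul_comm (n : ℕ)]
  · rw [← hinj.summable_iff (fun m hm => by simp [hb0 m hm])]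
    refine Summable.of_nonneg_of_le (fun n => mul_nonneg (sq_nonneg _) (weight_pos t _).le)
      (fun n => ?_) (f.summable_coeff.mul_left (max 1 ((k : ℝ) ^ t)))
    simp only [Function.comp, hbk]
    calc _ ≤ ‖f.coeff n‖ ^ 2 * (max 1 ((k : ℝ) ^ t) * ((n : ℝ) + 1) ^ t) :=
          mul_le_mul_of_nonneg_left (weight_mul_le t k n) (sq_nonneg _)
      _ = _ := by ring

/-- The power dilation `z ↦ f(zᵏ)`, an element of the same space. -/
def powerDilation (f : DirichletType t) (k : ℕ+) : DirichletType t :=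
  ⟨fun z => f (z ^ k), f.comp_pow_mem k⟩

end DirichletType

/-- The Hardy space `H₀²(𝔻)` of functions `f(z) = ∑_{n ≥ 1} aₙ zⁿ` with `‖f‖² = ∑ |aₙ|² < ∞`, which is
the space `𝒟₀`. -/
abbrev HardyZero : Type := DirichletType 0

/-! ### The Hardy spaces on the infinite torus -/

instance : MeasurableSpace Circle := borel Circle

instance : BorelSpace Circle := ⟨rfl⟩

/-- The infinite torus `𝕋^∞`, a compact topological group. -/
abbrev InfTorus : Type := ℕ → Circle

/-- The normalized Haar measure `ρ` of `𝕋^∞`. -/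
def torusMeasure : Measure InfTorus := Measure.haarMeasure ⊤

instance : IsProbabilityMeasure torusMeasure :=
  ⟨Measure.haarMeasure_self (K₀ := (⊤ : TopologicalSpace.PositiveCompacts InfTorus))⟩

instance : torusMeasure.IsMulLeftInvariant :=
  inferInstanceAs (Measure.haarMeasure (⊤ : TopologicalSpace.PositiveCompacts InfTorus)).IsMulLeftInvariant

/-- The monomial `ζ^α = ∏ₘ ζₘ^{αₘ}` for a finitely supported exponent sequence `α`. -/
def torusMonomial (α : ℕ →₀ ℕ) : C(InfTorus, ℂ) where
  toFun ζ := α.prod fun m e => (ζ m : ℂ) ^ e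
  continuous_toFun := by unfold Finsupp.prod; fun_prop

/-- The Hardy space `H²(𝕋^∞)`: the closed linear span of the monomials in `L²(𝕋^∞, ρ)`. -/
def hardyTorus : Submodule ℂ (Lp ℂ 2 torusMeasure) :=
  (Submodule.span ℂ (Set.range fun α : ℕ →₀ ℕ =>
    ContinuousMap.toLp 2 torusMeasure ℂ (torusMonomial α))).topologicalClosure

instance : CompleteSpace hardyTorus :=
  (Submodule.isClosed_topologicalClosure _).completeSpace_coe

/-- The monomial `ζ^α` as an element of `H²(𝕋^∞)`. -/
def hardyMonomial (α : ℕ →₀ ℕ) : hardyTorus :=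
  ⟨ContinuousMap.toLp 2 torusMeasure ℂ (torusMonomial α),
    Submodule.le_topologicalClosure _ (Submodule.subset_span ⟨α, rfl⟩)⟩

/-- The exponent sequence `α(n)` of a positive integer `n = ∏ₘ pₘ^{αₘ}`, where `p₀ < p₁ < …` are the
primes. -/
def primeExponents (n : ℕ+) : ℕ →₀ ℕ :=
  (n : ℕ).factorization.comapDomain (Nat.nth Nat.Prime)
    (Nat.nth_injective Nat.infinite_setOfPred_prime).injOn

theorem primeExponents_injective : Function.Injective primeExponents := by
  intro n k h
  refine PNat.eq (Nat.eq_of_factorization_eq n.ne_zero k.ne_zero fun p => ?_)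
  by_cases hp : p.Prime
  · obtain ⟨m, rfl⟩ : ∃ m, Nat.nth Nat.Prime m = p := ⟨_, Nat.nth_count hp⟩
    exact DFunLike.congr_fun h m
  · rw [Nat.factorization_eq_zero_of_not_prime _ hp, Nat.factorization_eq_zero_of_not_prime _ hp]

theorem torusMonomial_mul (α : ℕ →₀ ℕ) (η ζ : InfTorus) :
    torusMonomial α (η * ζ) = torusMonomial α η * torusMonomial α ζ := by
  simp [torusMonomial, Finsupp.prod, mul_pow, Finset.prod_mul_distrib]

theorem norm_torusMonomial (α : ℕ →₀ ℕ) (ζ : InfTorus) : ‖torusMonomial α ζ‖ = 1 := by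
  simp only [torusMonomial, Finsupp.prod, ContinuousMap.coe_mk, norm_prod, norm_pow]
  exact Finset.prod_eq_one fun m _ => by rw [Circle.norm_coe (ζ m), one_pow]

theorem exists_circle_pow_ne {a b : ℕ} (h : a ≠ b) : ∃ u : Circle, (u : ℂ) ^ a ≠ (u : ℂ) ^ b := by
  have hs : (0 : ℝ) < a + b + 1 := by positivity
  have harg : ∀ c : ℕ, (c : ℝ) ≤ a + b →
      Complex.arg ((Circle.exp (Real.pi / (a + b + 1)) ^ c : Circle) : ℂ) =
        c * (Real.pi / (a + b + 1)) := by
    intro c hc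
    rw [← Circle.exp_nsmul, nsmul_eq_mul]
    refine Circle.arg_exp ?_ ?_
    · have : 0 ≤ (c : ℝ) * (Real.pi / (a + b + 1)) := by positivity
      linarith [Real.pi_pos]
    · rw [← mul_div_assoc, div_le_iff₀ hs]
      nlinarith [Real.pi_pos]
  refine ⟨Circle.exp (Real.pi / (a + b + 1)), fun he => h ?_⟩
  have h1 := harg a (by linarith [(Nat.cast_nonneg b : (0 : ℝ) ≤ b)])
  have h2 := harg b (by linarith [(Nat.cast_nonneg a : (0 : ℝ) ≤ a)])
  have hpos : Real.pi / (a + b + 1) ≠ 0 := (div_pos Real.pi_pos hs).ne'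
  rw [Circle.coe_pow] at h1 h2
  rw [he, h2] at h1
  exact_mod_cast (mul_right_cancel₀ hpos h1).symm

theorem orthonormal_hardyMonomial : Orthonormal ℂ hardyMonomial := by
  have hin : ∀ α β, inner ℂ (hardyMonomial α) (hardyMonomial β) =
      ∫ ζ, torusMonomial β ζ * conj (torusMonomial α ζ) ∂torusMeasure := fun α β => by
    rw [Submodule.coe_inner]
    exact ContinuousMap.inner_toLp torusMeasure (torusMonomial α) (torusMonomial β)
  constructor
  · intro α
    have h1 : inner ℂ (hardyMonomial α) (hardyMonomial α) = 1 := by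
      rw [hin]
      simp [Complex.mul_conj', norm_torusMonomial]
    have h2 : ‖hardyMonomial α‖ ^ 2 = 1 := by
      have h3 := (inner_self_eq_norm_sq_to_K (𝕜 := ℂ) (hardyMonomial α)).symm.trans h1
      exact Complex.ofReal_injective (by simpa using h3)
    nlinarith [norm_nonneg (hardyMonomial α)]
  · intro α β hne
    rw [hin]
    obtain ⟨m, hm⟩ : ∃ m, α m ≠ β m := by
      by_contra! h
      exact hne (Finsupp.ext h)
    obtain ⟨u, hu⟩ := exists_circle_pow_ne hm
    set η : InfTorus := Pi.mulSingle m u with hη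
    have hval : ∀ γ : ℕ →₀ ℕ, torusMonomial γ η = (u : ℂ) ^ γ m := fun γ => by
      simp only [torusMonomial, ContinuousMap.coe_mk]
      rw [Finsupp.prod_eq_single m]
      · simp [hη]
      · intro i _ hi
        simp [hη, Pi.mulSingle_eq_of_ne hi]
      · simp
    have hinv := integral_mul_left_eq_self (μ := torusMeasure)
      (fun ζ => torusMonomial β ζ * conj (torusMonomial α ζ)) η
    have hc : (fun ζ => torusMonomial β (η * ζ) * conj (torusMonomial α (η * ζ))) = fun ζ =>
        ((u : ℂ) ^ β m * conj ((u : ℂ) ^ α m)) *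
          (torusMonomial β ζ * conj (torusMonomial α ζ)) := by
      funext ζ
      simp only [torusMonomial_mul, hval, map_mul]
      ring
    rw [hc, integral_const_mul] at hinv
    have hne1 : (u : ℂ) ^ β m * conj ((u : ℂ) ^ α m) ≠ 1 := fun h => hu <| by
      have h2 : (u : ℂ) ^ α m * conj ((u : ℂ) ^ α m) = 1 := by
        rw [Complex.mul_conj', norm_pow, Circle.norm_coe]; simp
      have h3 : conj ((u : ℂ) ^ α m) ≠ 0 := right_ne_zero_of_mul_eq_one h2
      exact mul_right_cancel₀ h3 (h2.trans h.symm)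
    have h0 : ((u : ℂ) ^ β m * conj ((u : ℂ) ^ α m) - 1) *
        ∫ ζ, torusMonomial β ζ * conj (torusMonomial α ζ) ∂torusMeasure = 0 := by
      rw [sub_mul, hinv, one_mul, sub_self]
    exact (mul_eq_zero.1 h0).resolve_left (sub_ne_zero.2 hne1)

/-- The Bohr transform `∑ aₙ zⁿ ↦ ∑ aₙ ζ^{α(n)}` from `H₀²(𝔻)` to `H²(𝕋^∞)`. -/
def bohr (f : HardyZero) : hardyTorus :=
  ∑' n : ℕ+, f.coeff n • hardyMonomial (primeExponents n)

/-- The series that defines the Bohr transform converges in `H²(𝕋^∞)`. -/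
theorem hasSum_bohr (f : HardyZero) :
    HasSum (fun n : ℕ+ => f.coeff n • hardyMonomial (primeExponents n)) (bohr f) := by
  have ho : Orthonormal ℂ fun n : ℕ+ => hardyMonomial (primeExponents n) :=
    orthonormal_hardyMonomial.comp _ primeExponents_injective
  have hs := (ho.orthogonalFamily.summable_iff_norm_sq_summable fun n => f.coeff n).2
    (by simpa using f.summable_coeff)
  exact Summable.hasSum (by simpa using hs)

/-- `H^∞(𝕋^∞)`: the (essentially) bounded functions in `H²(𝕋^∞)`. -/
def hardyInfty : Set hardyTorus :=
  {F | MemLp (F : Lp ℂ 2 torusMeasure) ⊤ torusMeasure}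

/-- `F` is invertible in the algebra `H^∞(𝕋^∞)`, whose product is the pointwise (almost everywhere)
product of functions and whose unit is the constant function `1`. -/
def IsInvertibleInHardyInfty (F : hardyTorus) : Prop :=
  F ∈ hardyInfty ∧ ∃ G ∈ hardyInfty, ∀ᵐ ζ ∂torusMeasure,
    (F : Lp ℂ 2 torusMeasure) ζ * (G : Lp ℂ 2 torusMeasure) ζ = 1

end

/-!
For `t = 0` everything is transported to `H²(𝕋^∞)` by the Bohr transform, which is unitary
(`bohrEquiv`) because `n ↦ α(n)` is a bijection from the positive integers onto the finitely
supported exponent sequences. It turns `f(zᵏ)` into `ζ^{α(k)} F` with `F = ℬf`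
(`bohr_powerDilation`), so the question is when the multiples of `F` by the orthonormal basis of
monomials form a frame.

* An upper frame bound `B` says that multiplication by `F` is bounded on analytic polynomials `p`,
  that is `∫ |F|² |p|² ≤ B ∫ |p|²`. A lower frame bound `A` gives `A ∫ |p|² ≤ ∫ |F|² |p|²`, by
  Bessel's inequality applied to `conj(F) p`. A trigonometric polynomial becomes analytic after
  multiplication by a unimodular monomial, and trigonometric polynomials are uniformly dense in
  `C(𝕋^∞)`, so these inequalities for integrals give `A ≤ |F|² ≤ B` almost everywhere
  (`ae_nonneg_of_integral_mul_norm_sq`). The lower bound also makes the span of the multiples of `F`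
  dense. Multiplication by the bounded function `1 / F` maps that span into the polynomials, hence
  all of `H²(𝕋^∞)` into itself, and `1 / F ∈ H^∞(𝕋^∞)`
  (`isInvertibleInHardyInfty_of_isFrame`).
* If `F` is invertible in `H^∞(𝕋^∞)`, then multiplication by `1 / F` is an isomorphism of
  `H²(𝕋^∞)` that takes `ζ^{α(k)} F` to `ζ^{α(k)}`
  (`isRieszBasis_of_isInvertibleInHardyInfty`).
* A Riesz basis is always a frame (`IsRieszBasis.isFrame`).

For `t ≠ 0` it suffices to test the frame inequalities on monomials: dividing by `(m + 1)ᵗ`, they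
read `A ≤ (m + 1)ᵗ ∑_{d ∣ m} |a_d|² ≤ B`. If `t > 0`, letting `m` run over the multiples of `d` in
the upper bound forces `a_d = 0` for every `d`; if `t < 0`, the middle term tends to `0` along the
primes.
-/

noncomputable section

/-! ### Frames and Riesz bases in Hilbert space -/

section Bases

variable {H K : Type*} [NormedAddCommGroup H] [InnerProductSpace ℂ H]
  [NormedAddCommGroup K] [InnerProductSpace ℂ K]

theorem IsFrame.map {x : ℕ+ → H} (hx : IsFrame x) (U : H ≃ₗᵢ[ℂ] K) :
    IsFrame fun k => U (x k) := by
  obtain ⟨A, B, hA, hB, h⟩ := hx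
  refine ⟨A, B, hA, hB, fun v => ?_⟩
  have hi : ∀ k, inner ℂ (U (x k)) v = inner ℂ (x k) (U.symm v) := fun k => by
    rw [← U.inner_map_map, U.apply_symm_apply]
  simpa only [hi, U.symm.norm_map] using h (U.symm v)

theorem IsRieszBasis.map {x : ℕ+ → H} (hx : IsRieszBasis x) (U : H ≃ₗᵢ[ℂ] K) :
    IsRieszBasis fun k => U (x k) := by
  obtain ⟨T, b, h⟩ := hx
  refine ⟨(U.symm.toContinuousLinearEquiv.trans T).trans U.toContinuousLinearEquiv,
    ⟨U.symm.trans b.repr⟩, fun k => ?_⟩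
  rw [← HilbertBasis.repr_symm_single]
  change U (T (U.symm (U (x k)))) = U (b.repr.symm (lp.single 2 k 1))
  rw [U.symm_apply_apply, h, b.repr_symm_single]

/-- If `T xₖ = bₖ` with `(bₖ)` orthonormal, then `∑ |⟨xₖ, h⟩|² = ‖(T⁻¹)* h‖²`, and `(T⁻¹)*` is
bounded above and below. -/
theorem IsRieszBasis.isFrame [CompleteSpace H] {x : ℕ+ → H} (hx : IsRieszBasis x) :
    IsFrame x := by
  obtain ⟨T, b, h⟩ := hx
  set S : H →L[ℂ] H := ContinuousLinearMap.adjoint (T.symm : H →L[ℂ] H) with hS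
  set R : H →L[ℂ] H := ContinuousLinearMap.adjoint (T : H →L[ℂ] H) with hR
  have hRS : ∀ v, R (S v) = v := fun v => by
    rw [hR, hS, ← ContinuousLinearMap.comp_apply, ← ContinuousLinearMap.adjoint_comp]
    simp [ContinuousLinearMap.adjoint_id]
  have hin : ∀ k v, inner ℂ (x k) v = inner ℂ (b k) (S v) := fun k v => by
    rw [hS, ContinuousLinearMap.adjoint_inner_right, ← h k]
    simp
  have hsum : ∀ v, HasSum (fun k => ‖inner ℂ (x k) v‖ ^ 2) (‖S v‖ ^ 2) := fun v => by
    have h1 := (b.hasSum_inner_mul_inner (S v) (S v)).mapL Complex.reCLM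
    rw [Complex.reCLM_apply] at h1
    have h2 : (inner ℂ (S v) (S v) : ℂ).re = ‖S v‖ ^ 2 := inner_self_eq_norm_sq (𝕜 := ℂ) (S v)
    rw [h2] at h1
    refine h1.congr_fun fun k => ?_
    rw [hin, Complex.reCLM_apply, ← inner_conj_symm (S v) (b k), Complex.conj_mul']
    norm_cast
  refine ⟨((‖R‖ + 1) ^ 2)⁻¹, (‖S‖ + 1) ^ 2, by positivity, by positivity, fun v =>
    ⟨(hsum v).summable, ?_, ?_⟩⟩
  · rw [(hsum v).tsum_eq, inv_mul_le_iff₀ (by positivity), ← mul_pow]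
    have h1 : ‖v‖ ≤ ‖R‖ * ‖S v‖ := by simpa only [hRS] using R.le_opNorm (S v)
    gcongr
    nlinarith [norm_nonneg (S v)]
  · rw [(hsum v).tsum_eq, ← mul_pow]
    have h1 := S.le_opNorm v
    gcongr
    nlinarith [norm_nonneg v]

/-- The upper frame bound, dualized: the synthesis operator `c ↦ ∑ cₖ xₖ` is bounded on `ℓ²`. -/
theorem norm_sq_sum_smul_le {x : ℕ+ → H} {B : ℝ} (hB : 0 ≤ B)
    (h : ∀ v : H, Summable (fun k => ‖inner ℂ (x k) v‖ ^ 2) ∧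
      ∑' k, ‖inner ℂ (x k) v‖ ^ 2 ≤ B * ‖v‖ ^ 2) (s : Finset ℕ+) (c : ℕ+ → ℂ) :
    ‖∑ k ∈ s, c k • x k‖ ^ 2 ≤ B * ∑ k ∈ s, ‖c k‖ ^ 2 := by
  set v := ∑ k ∈ s, c k • x k with hv
  have h1 : ‖v‖ ^ 2 ≤ ∑ k ∈ s, ‖c k‖ * ‖inner ℂ (x k) v‖ := by
    have h2 : (inner ℂ v v : ℂ) = ∑ k ∈ s, conj (c k) * inner ℂ (x k) v := by
      conv_lhs => rw [hv]
      rw [sum_inner]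
      exact Finset.sum_congr rfl fun k _ => by rw [inner_smul_left]
    have h3 : ‖(inner ℂ v v : ℂ)‖ = ‖v‖ ^ 2 := by
      rw [inner_self_eq_norm_sq_to_K]; simp
    rw [← h3, h2]
    refine (norm_sum_le _ _).trans (Finset.sum_le_sum fun k _ => ?_)
    rw [norm_mul, RCLike.norm_conj]
  have h4 : (‖v‖ ^ 2) ^ 2 ≤ (∑ k ∈ s, ‖c k‖ ^ 2) * (B * ‖v‖ ^ 2) := by
    calc (‖v‖ ^ 2) ^ 2 ≤ (∑ k ∈ s, ‖c k‖ * ‖inner ℂ (x k) v‖) ^ 2 := by gcongr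
      _ ≤ (∑ k ∈ s, ‖c k‖ ^ 2) * ∑ k ∈ s, ‖inner ℂ (x k) v‖ ^ 2 :=
        Finset.sum_mul_sq_le_sq_mul_sq _ _ _
      _ ≤ _ := by
        gcongr
        exact ((h v).1.sum_le_tsum s fun k _ => sq_nonneg _).trans (h v).2
  rcases (sq_nonneg ‖v‖).eq_or_lt with h0 | h0
  · rw [← h0]
    positivity
  · nlinarith

end Bases

/-! ### Trigonometric polynomials on the infinite torus -/

theorem torusMonomial_zero : torusMonomial 0 = 1 := by
  ext ζ
  simp [torusMonomial]

theorem torusMonomial_add (α β : ℕ →₀ ℕ) :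
    torusMonomial (α + β) = torusMonomial α * torusMonomial β := by
  ext ζ
  exact Finsupp.prod_add_index' (fun _ => pow_zero _) fun _ _ _ => pow_add _ _ _

theorem torusMonomial_mul_star (α : ℕ →₀ ℕ) : torusMonomial α * star (torusMonomial α) = 1 := by
  ext ζ
  simp [Complex.mul_conj', norm_torusMonomial]

/-- The analytic polynomials: the linear span of the monomials `ζ^α`, `α ≥ 0`. -/
def torusPolynomials : Submodule ℂ C(InfTorus, ℂ) :=
  Submodule.span ℂ (Set.range torusMonomial)

theorem torusMonomial_mem (α : ℕ →₀ ℕ) : torusMonomial α ∈ torusPolynomials :=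
  Submodule.subset_span ⟨α, rfl⟩

theorem torusPolynomials_mul_mem {p q : C(InfTorus, ℂ)} (hp : p ∈ torusPolynomials)
    (hq : q ∈ torusPolynomials) : p * q ∈ torusPolynomials := by
  have h := Submodule.mul_mem_mul hp hq
  rw [torusPolynomials, Submodule.span_mul_span] at h
  refine Submodule.span_mono ?_ h
  rintro _ ⟨_, ⟨α, rfl⟩, _, ⟨β, rfl⟩, rfl⟩
  exact ⟨α + β, torusMonomial_add α β⟩

theorem exists_monomial_mul_star_mem {p : C(InfTorus, ℂ)} (hp : p ∈ torusPolynomials) :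
    ∃ γ, torusMonomial γ * star p ∈ torusPolynomials := by
  induction hp using Submodule.span_induction with
  | mem x hx =>
    obtain ⟨α, rfl⟩ := hx
    exact ⟨α, by rw [torusMonomial_mul_star, ← torusMonomial_zero]; exact torusMonomial_mem 0⟩
  | zero => exact ⟨0, by simp⟩
  | add x y _ _ hx hy =>
    obtain ⟨γ, hγ⟩ := hx
    obtain ⟨δ, hδ⟩ := hy
    refine ⟨γ + δ, ?_⟩
    have h : torusMonomial (γ + δ) * star (x + y) =
        torusMonomial δ * (torusMonomial γ * star x) +
          torusMonomial γ * (torusMonomial δ * star y) := by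
      rw [torusMonomial_add, star_add]; ring
    rw [h]
    exact add_mem (torusPolynomials_mul_mem (torusMonomial_mem δ) hγ)
      (torusPolynomials_mul_mem (torusMonomial_mem γ) hδ)
  | smul c x _ hx =>
    obtain ⟨γ, hγ⟩ := hx
    refine ⟨γ, ?_⟩
    rw [star_smul, mul_smul_comm]
    exact Submodule.smul_mem _ _ hγ

/-- The trigonometric polynomials, described as the continuous functions that become analytic
polynomials after multiplication by a monomial. -/
def trigPolynomials : StarSubalgebra ℂ C(InfTorus, ℂ) where
  carrier := {q | ∃ α, torusMonomial α * q ∈ torusPolynomials}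
  mul_mem' := by
    rintro p q ⟨α, hα⟩ ⟨β, hβ⟩
    refine ⟨α + β, ?_⟩
    have h := torusPolynomials_mul_mem hα hβ
    rwa [mul_mul_mul_comm, ← torusMonomial_add] at h
  add_mem' := by
    rintro p q ⟨α, hα⟩ ⟨β, hβ⟩
    refine ⟨α + β, ?_⟩
    have h : torusMonomial (α + β) * (p + q) =
        torusMonomial β * (torusMonomial α * p) + torusMonomial α * (torusMonomial β * q) := by
      rw [torusMonomial_add]; ring
    rw [h]
    exact add_mem (torusPolynomials_mul_mem (torusMonomial_mem β) hα)
      (torusPolynomials_mul_mem (torusMonomial_mem α) hβ)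
  algebraMap_mem' c := ⟨0, by
    rw [torusMonomial_zero, one_mul, Algebra.algebraMap_eq_smul_one, ← torusMonomial_zero]
    exact Submodule.smul_mem _ _ (torusMonomial_mem 0)⟩
  star_mem' := by
    rintro q ⟨α, hα⟩
    obtain ⟨γ, hγ⟩ := exists_monomial_mul_star_mem hα
    refine ⟨γ, ?_⟩
    have h : torusMonomial γ * star q =
        torusMonomial α * (torusMonomial γ * star (torusMonomial α * q)) := by
      rw [star_mul']
      calc _ = (torusMonomial α * star (torusMonomial α)) * (torusMonomial γ * star q) := by
            rw [torusMonomial_mul_star, one_mul]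
        _ = _ := by ring
    rw [h]
    exact torusPolynomials_mul_mem (torusMonomial_mem α) hγ

theorem trigPolynomials_topologicalClosure : trigPolynomials.topologicalClosure = ⊤ := by
  refine ContinuousMap.starSubalgebra_topologicalClosure_eq_top_of_separatesPoints _ ?_
  intro ζ η hne
  obtain ⟨m, hm⟩ := Function.ne_iff.1 hne
  have hval : ∀ ξ : InfTorus, torusMonomial (Finsupp.single m 1) ξ = ξ m := fun ξ => by
    simp [torusMonomial]
  refine ⟨_, ⟨torusMonomial (Finsupp.single m 1), ⟨0, ?_⟩, rfl⟩, ?_⟩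
  · rw [torusMonomial_zero, one_mul]
    exact torusMonomial_mem _
  · simp only [hval]
    exact fun h => hm (Circle.ext h)

/-! ### Integrals against squares of polynomials determine the sign of a weight -/

theorem continuous_integral_mul_norm_sq {w : InfTorus → ℝ} (hw : Integrable w torusMeasure) :
    Continuous fun q : C(InfTorus, ℂ) => ∫ ζ, w ζ * ‖q ζ‖ ^ 2 ∂torusMeasure := by
  refine continuous_iff_continuousAt.2 fun q₀ => ?_
  refine continuousAt_of_dominated (bound := fun ζ => |w ζ| * (‖q₀‖ + 1) ^ 2) ?_ ?_
    (hw.abs.mul_const _) ?_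
  · exact Filter.Eventually.of_forall fun q => hw.aestronglyMeasurable.mul
      (by fun_prop : Continuous fun ζ => ‖q ζ‖ ^ 2).aestronglyMeasurable
  · filter_upwards [Metric.ball_mem_nhds q₀ one_pos] with q hq
    refine Filter.Eventually.of_forall fun ζ => ?_
    have h1 : ‖q ζ‖ ≤ ‖q₀‖ + 1 := by
      have h2 : ‖q - q₀‖ < 1 := by rwa [← dist_eq_norm]
      have h3 : ‖q‖ ≤ ‖q₀‖ + ‖q - q₀‖ := by simpa using norm_add_le q₀ (q - q₀)
      linarith [q.norm_coe_le_norm ζ]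
    rw [norm_mul, Real.norm_eq_abs, norm_pow, norm_norm]
    gcongr
  · exact Filter.Eventually.of_forall fun ζ =>
      (by fun_prop : Continuous fun q : C(InfTorus, ℂ) => w ζ * ‖q ζ‖ ^ 2).continuousAt

theorem integral_mul_norm_sq_nonneg {w : InfTorus → ℝ} (hw : Integrable w torusMeasure)
    (h : ∀ p ∈ torusPolynomials, 0 ≤ ∫ ζ, w ζ * ‖p ζ‖ ^ 2 ∂torusMeasure) (q : C(InfTorus, ℂ)) :
    0 ≤ ∫ ζ, w ζ * ‖q ζ‖ ^ 2 ∂torusMeasure := by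
  have hcl : IsClosed {q : C(InfTorus, ℂ) | 0 ≤ ∫ ζ, w ζ * ‖q ζ‖ ^ 2 ∂torusMeasure} :=
    isClosed_le continuous_const (continuous_integral_mul_norm_sq hw)
  have hq : q ∈ closure (trigPolynomials : Set C(InfTorus, ℂ)) := by
    rw [← StarSubalgebra.topologicalClosure_coe, trigPolynomials_topologicalClosure]
    trivial
  refine closure_minimal ?_ hcl hq
  rintro q ⟨α, hα⟩
  -- multiplication by a unimodular monomial does not change `|q|`
  have := h _ hα
  simpa [norm_torusMonomial] using this

/-- A weight `w` is nonnegative almost everywhere as soon as `∫ w |p|² ≥ 0` for all analytic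
polynomials `p`: the analytic polynomials have the same moduli as the trigonometric ones, which are
uniformly dense in `C(𝕋^∞)`. -/
theorem ae_nonneg_of_integral_mul_norm_sq {w : InfTorus → ℝ} (hw : Integrable w torusMeasure)
    (h : ∀ p ∈ torusPolynomials, 0 ≤ ∫ ζ, w ζ * ‖p ζ‖ ^ 2 ∂torusMeasure) :
    ∀ᵐ ζ ∂torusMeasure, 0 ≤ w ζ := by
  have hclosed : ∀ K : Set InfTorus, IsClosed K → 0 ≤ ∫ ζ in K, w ζ ∂torusMeasure := by
    intro K hK
    have hlim : Filter.Tendsto (fun n => ∫ ζ, w ζ * (hK.apprSeq n ζ : ℝ) ∂torusMeasure)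
        Filter.atTop (nhds (∫ ζ, K.indicator w ζ ∂torusMeasure)) := by
      refine tendsto_integral_of_dominated_convergence (fun ζ => |w ζ|) ?_ hw.abs ?_ ?_
      · exact fun n => hw.aestronglyMeasurable.mul
          (by fun_prop : Continuous fun ζ => (hK.apprSeq n ζ : ℝ)).aestronglyMeasurable
      · refine fun n => Filter.Eventually.of_forall fun ζ => ?_
        rw [norm_mul, Real.norm_eq_abs, NNReal.norm_eq]
        have := HasOuterApproxClosed.apprSeq_apply_le_one hK n ζ
        exact mul_le_of_le_one_right (abs_nonneg _) (by exact_mod_cast this)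
      · refine Filter.Eventually.of_forall fun ζ => ?_
        have h1 := tendsto_pi_nhds.1 (HasOuterApproxClosed.tendsto_apprSeq hK) ζ
        have h2 := (((NNReal.continuous_coe.tendsto _).comp h1).const_mul (w ζ))
        have h3 : K.indicator w ζ = w ζ * ((K.indicator (fun _ => (1 : NNReal)) ζ : NNReal) : ℝ) := by
          by_cases hζ : ζ ∈ K <;> simp [hζ]
        rw [h3]
        exact h2
    rw [← integral_indicator hK.measurableSet]
    refine ge_of_tendsto' hlim fun n => ?_
    -- a nonnegative continuous function is the square of its continuous square root
    have h1 := integral_mul_norm_sq_nonneg hw h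
      ⟨fun ζ => ((Real.sqrt (hK.apprSeq n ζ : ℝ) : ℝ) : ℂ), by fun_prop⟩
    refine h1.trans_eq (integral_congr_ae (Filter.Eventually.of_forall fun ζ => ?_))
    simp [Real.sq_sqrt]
  set v := hw.aestronglyMeasurable.mk w with hv
  have hwv : w =ᵐ[torusMeasure] v := hw.aestronglyMeasurable.ae_eq_mk
  have hvm : Measurable v := hw.aestronglyMeasurable.stronglyMeasurable_mk.measurable
  have hvi : Integrable v torusMeasure := hw.congr hwv
  have hmeas : MeasurableSet {ζ | v ζ < 0} := measurableSet_lt hvm measurable_const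
  -- otherwise inner regularity gives a closed set of positive measure on which `w < 0`
  have hzero : torusMeasure {ζ | v ζ < 0} = 0 := by
    by_contra hne
    obtain ⟨K, hKs, hK, hpos⟩ := hmeas.exists_lt_isClosed_of_ne_top
      (measure_ne_top torusMeasure _) (pos_iff_ne_zero.2 hne)
    have h1 : 0 < ∫ ζ in K, (-v) ζ ∂torusMeasure := by
      rw [setIntegral_pos_iff_support_of_nonneg_ae _ hvi.neg.integrableOn]
      · refine hpos.trans_le (measure_mono fun ζ hζ => ⟨?_, hζ⟩)
        have : v ζ < 0 := hKs hζ
        simpa using this.ne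
      · refine (ae_restrict_iff' hK.measurableSet).2 (Filter.Eventually.of_forall fun ζ hζ => ?_)
        have : v ζ < 0 := hKs hζ
        simpa using this.le
    have h2 := hclosed K hK
    rw [integral_congr_ae (ae_restrict_of_ae hwv)] at h2
    rw [integral_neg'] at h1
    linarith
  have hae : ∀ᵐ ζ ∂torusMeasure, ¬ v ζ < 0 := by
    rw [ae_iff]
    simpa using hzero
  filter_upwards [hwv, hae] with ζ h1 h2
  rw [h1]
  exact not_lt.1 h2

/-! ### Multiplication operators on `L²(𝕋^∞)` -/

/-- Multiplication of an `L²` function by an essentially bounded function. -/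
def torusMul : Lp ℂ ⊤ torusMeasure →L[ℂ] Lp ℂ 2 torusMeasure →L[ℂ] Lp ℂ 2 torusMeasure :=
  (ContinuousLinearMap.mul ℂ ℂ).holderL torusMeasure ⊤ 2 2

theorem coeFn_torusMul (φ : Lp ℂ ⊤ torusMeasure) (g : Lp ℂ 2 torusMeasure) :
    torusMul φ g =ᵐ[torusMeasure] fun ζ => φ ζ * g ζ :=
  (ContinuousLinearMap.mul ℂ ℂ).coeFn_holder (r := 2) φ g

theorem coeFn_torusMul_toLp (p : C(InfTorus, ℂ)) (g : Lp ℂ 2 torusMeasure) :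
    torusMul (ContinuousMap.toLp ⊤ torusMeasure ℂ p) g =ᵐ[torusMeasure] fun ζ => p ζ * g ζ := by
  filter_upwards [coeFn_torusMul (ContinuousMap.toLp ⊤ torusMeasure ℂ p) g,
    ContinuousMap.coeFn_toLp (p := ⊤) (𝕜 := ℂ) torusMeasure p] with ζ h1 h2
  rw [h1, h2]

theorem torusMul_toLp_toLp (p q : C(InfTorus, ℂ)) :
    torusMul (ContinuousMap.toLp ⊤ torusMeasure ℂ p) (ContinuousMap.toLp 2 torusMeasure ℂ q) =
      ContinuousMap.toLp 2 torusMeasure ℂ (p * q) := by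
  refine Lp.ext ?_
  filter_upwards [coeFn_torusMul_toLp p (ContinuousMap.toLp 2 torusMeasure ℂ q),
    ContinuousMap.coeFn_toLp (p := 2) (𝕜 := ℂ) torusMeasure q,
    ContinuousMap.coeFn_toLp (p := 2) (𝕜 := ℂ) torusMeasure (p * q)] with ζ h1 h2 h3
  rw [h1, h2, h3, ContinuousMap.mul_apply]

theorem norm_sq_eq_integral (g : Lp ℂ 2 torusMeasure) :
    ‖g‖ ^ 2 = ∫ ζ, ‖g ζ‖ ^ 2 ∂torusMeasure := by
  have h1 : (inner ℂ g g : ℂ) = ((‖g‖ ^ 2 : ℝ) : ℂ) := by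
    rw [inner_self_eq_norm_sq_to_K]; norm_cast
  rw [L2.inner_def] at h1
  have h2 : ∀ ζ, (inner ℂ (g ζ) (g ζ) : ℂ) = ((‖g ζ‖ ^ 2 : ℝ) : ℂ) := fun ζ => by
    rw [inner_self_eq_norm_sq_to_K]; norm_cast
  simp only [h2] at h1
  rw [integral_complex_ofReal] at h1
  exact_mod_cast h1.symm

theorem integrable_norm_sq (g : Lp ℂ 2 torusMeasure) :
    Integrable (fun ζ => ‖g ζ‖ ^ 2) torusMeasure :=
  (Lp.memLp g).integrable_norm_pow two_ne_zero

theorem norm_sq_torusMul_toLp (p : C(InfTorus, ℂ)) (g : Lp ℂ 2 torusMeasure) :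
    ‖torusMul (ContinuousMap.toLp ⊤ torusMeasure ℂ p) g‖ ^ 2 =
      ∫ ζ, ‖g ζ‖ ^ 2 * ‖p ζ‖ ^ 2 ∂torusMeasure := by
  rw [norm_sq_eq_integral]
  refine integral_congr_ae ?_
  filter_upwards [coeFn_torusMul_toLp p g] with ζ h
  rw [h, norm_mul, mul_pow, mul_comm]

theorem norm_sq_toLp (p : C(InfTorus, ℂ)) :
    ‖ContinuousMap.toLp 2 torusMeasure ℂ p‖ ^ 2 = ∫ ζ, ‖p ζ‖ ^ 2 ∂torusMeasure := by
  rw [norm_sq_eq_integral]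
  refine integral_congr_ae ?_
  filter_upwards [ContinuousMap.coeFn_toLp (p := 2) (𝕜 := ℂ) torusMeasure p] with ζ h
  rw [h]

theorem toLp_mem_hardyTorus {p : C(InfTorus, ℂ)} (hp : p ∈ torusPolynomials) :
    ContinuousMap.toLp 2 torusMeasure ℂ p ∈ hardyTorus := by
  refine Submodule.le_topologicalClosure _ ?_
  have h := Submodule.mem_map_of_mem (f := (ContinuousMap.toLp 2 torusMeasure ℂ :
    C(InfTorus, ℂ) →L[ℂ] Lp ℂ 2 torusMeasure).toLinearMap) hp
  rw [torusPolynomials, Submodule.map_span, ← Set.range_comp] at h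
  exact h

/-- A bounded operator on `L²(𝕋^∞)` that maps the monomials into `H²(𝕋^∞)` maps `H²(𝕋^∞)` into
itself. -/
theorem map_mem_hardyTorus (S : Lp ℂ 2 torusMeasure →L[ℂ] Lp ℂ 2 torusMeasure)
    (h : ∀ α, S (ContinuousMap.toLp 2 torusMeasure ℂ (torusMonomial α)) ∈ hardyTorus)
    {g : Lp ℂ 2 torusMeasure} (hg : g ∈ hardyTorus) : S g ∈ hardyTorus := by
  have hle : hardyTorus ≤ hardyTorus.comap (S : Lp ℂ 2 torusMeasure →ₗ[ℂ] Lp ℂ 2 torusMeasure) := by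
    refine Submodule.topologicalClosure_minimal _ (Submodule.span_le.2 ?_) ?_
    · rintro _ ⟨α, rfl⟩
      exact h α
    · exact (Submodule.isClosed_topologicalClosure _).preimage S.continuous
  exact hle hg

theorem torusMul_monomial_mem (α : ℕ →₀ ℕ) {g : Lp ℂ 2 torusMeasure} (hg : g ∈ hardyTorus) :
    torusMul (ContinuousMap.toLp ⊤ torusMeasure ℂ (torusMonomial α)) g ∈ hardyTorus := by
  refine map_mem_hardyTorus _ (fun β => ?_) hg
  rw [torusMul_toLp_toLp, ← torusMonomial_add]
  exact toLp_mem_hardyTorus (torusMonomial_mem _)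

/-- `H²(𝕋^∞)` is invariant under multiplication by functions in `H^∞(𝕋^∞)`. -/
theorem torusMul_mem {φ : Lp ℂ ⊤ torusMeasure} {F : Lp ℂ 2 torusMeasure} (hF : F ∈ hardyTorus)
    (hφ : φ =ᵐ[torusMeasure] F) {g : Lp ℂ 2 torusMeasure} (hg : g ∈ hardyTorus) :
    torusMul φ g ∈ hardyTorus := by
  refine map_mem_hardyTorus _ (fun β => ?_) hg
  have h : torusMul φ (ContinuousMap.toLp 2 torusMeasure ℂ (torusMonomial β)) =
      torusMul (ContinuousMap.toLp ⊤ torusMeasure ℂ (torusMonomial β)) F := by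
    refine Lp.ext ?_
    filter_upwards [coeFn_torusMul φ (ContinuousMap.toLp 2 torusMeasure ℂ (torusMonomial β)),
      coeFn_torusMul_toLp (torusMonomial β) F, hφ,
      ContinuousMap.coeFn_toLp (p := 2) (𝕜 := ℂ) torusMeasure (torusMonomial β)] with ζ h1 h2 h3 h4
    rw [h1, h2, h3, h4, mul_comm]
  rw [h]
  exact torusMul_monomial_mem β hF

/-! ### Monomials indexed by positive integers -/

theorem primeExponents_surjective : Function.Surjective primeExponents := by
  intro α
  have hinj : Function.Injective (Nat.nth Nat.Prime) :=
    Nat.nth_injective Nat.infinite_setOfPred_prime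
  have hβ : ∀ p ∈ (α.mapDomain (Nat.nth Nat.Prime)).support, p.Prime := fun p hp => by
    obtain ⟨m, -, rfl⟩ := Finset.mem_image.1 (Finsupp.mapDomain_support hp)
    exact Nat.prime_nth_prime m
  refine ⟨Nat.factorizationEquiv.symm ⟨_, hβ⟩, ?_⟩
  have h : ((Nat.factorizationEquiv.symm ⟨_, hβ⟩ : ℕ+) : ℕ).factorization =
      α.mapDomain (Nat.nth Nat.Prime) :=
    congrArg Subtype.val (Nat.factorizationEquiv.apply_symm_apply ⟨_, hβ⟩)
  ext m
  rw [primeExponents, Finsupp.comapDomain_apply, h, Finsupp.mapDomain_apply hinj]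

theorem primeExponents_mul (n k : ℕ+) :
    primeExponents (n * k) = primeExponents n + primeExponents k := by
  ext m
  simp [primeExponents, Nat.factorization_mul]

/-- The monomials `ζ^{α(n)}`, `n ≥ 1`, form an orthonormal basis of `H²(𝕋^∞)`. -/
def hardyBasis : HilbertBasis ℕ+ ℂ hardyTorus :=
  HilbertBasis.mk (v := fun n : ℕ+ => hardyMonomial (primeExponents n))
    (orthonormal_hardyMonomial.comp _ primeExponents_injective) (by
      have hr : (Set.range fun n : ℕ+ => hardyMonomial (primeExponents n)) =
          Set.range hardyMonomial := primeExponents_surjective.range_comp hardyMonomial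
      rw [hr]
      rintro ⟨g, hg⟩ -
      have h1 : g ∈ closure ((↑) '' (Submodule.span ℂ (Set.range hardyMonomial) :
          Set hardyTorus) : Set (Lp ℂ 2 torusMeasure)) := by
        have h2 : (Subtype.val '' (Submodule.span ℂ (Set.range hardyMonomial) : Set hardyTorus) :
            Set (Lp ℂ 2 torusMeasure)) = (Submodule.span ℂ (Set.range fun α : ℕ →₀ ℕ =>
              ContinuousMap.toLp 2 torusMeasure ℂ (torusMonomial α)) :
              Set (Lp ℂ 2 torusMeasure)) := by
          have h3 := Submodule.map_span hardyTorus.subtype (Set.range hardyMonomial)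
          rw [← Set.range_comp] at h3
          exact congrArg SetLike.coe h3
        rw [h2]
        exact hg
      exact closure_subtype.2 h1)

theorem hardyBasis_apply (n : ℕ+) : hardyBasis n = hardyMonomial (primeExponents n) :=
  congrFun (HilbertBasis.coe_mk _ _) n

theorem exists_finsupp_of_mem_torusPolynomials {p : C(InfTorus, ℂ)} (hp : p ∈ torusPolynomials) :
    ∃ c : ℕ+ →₀ ℂ, p = ∑ k ∈ c.support, c k • torusMonomial (primeExponents k) := by
  rw [torusPolynomials, ← primeExponents_surjective.range_comp torusMonomial] at hp
  obtain ⟨c, hc⟩ := Finsupp.mem_span_range_iff_exists_finsupp.1 hp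
  exact ⟨c, hc.symm⟩

/-! ### Frames of monomial multiples -/

section MonomialMultiples

variable {F : Lp ℂ 2 torusMeasure} {x : ℕ+ → hardyTorus}

/-- Under an upper frame bound, multiplication by `F` is bounded on analytic polynomials. -/
theorem integral_le_of_upper_bound {B : ℝ} (hB : 0 ≤ B)
    (hx : ∀ k, (x k : Lp ℂ 2 torusMeasure) =
      torusMul (ContinuousMap.toLp ⊤ torusMeasure ℂ (torusMonomial (primeExponents k))) F)
    (h : ∀ v : hardyTorus, Summable (fun k => ‖inner ℂ (x k) v‖ ^ 2) ∧
      ∑' k, ‖inner ℂ (x k) v‖ ^ 2 ≤ B * ‖v‖ ^ 2)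
    {p : C(InfTorus, ℂ)} (hp : p ∈ torusPolynomials) :
    ∫ ζ, ‖F ζ‖ ^ 2 * ‖p ζ‖ ^ 2 ∂torusMeasure ≤ B * ∫ ζ, ‖p ζ‖ ^ 2 ∂torusMeasure := by
  obtain ⟨c, hc⟩ := exists_finsupp_of_mem_torusPolynomials hp
  have h1 : torusMul (ContinuousMap.toLp ⊤ torusMeasure ℂ p) F =
      ((∑ k ∈ c.support, c k • x k : hardyTorus) : Lp ℂ 2 torusMeasure) := by
    rw [hc]
    simp [hx]
  have h2 : ContinuousMap.toLp 2 torusMeasure ℂ p =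
      ((∑ k ∈ c.support, c k • hardyBasis k : hardyTorus) : Lp ℂ 2 torusMeasure) := by
    rw [hc]
    simp [hardyBasis_apply, hardyMonomial]
  have h3 : ‖(∑ k ∈ c.support, c k • hardyBasis k : hardyTorus)‖ ^ 2 =
      ∑ k ∈ c.support, ‖c k‖ ^ 2 := by
    have h4 := hardyBasis.orthonormal.inner_sum c c c.support
    rw [inner_self_eq_norm_sq_to_K] at h4
    simp only [Complex.conj_mul'] at h4
    exact Complex.ofReal_injective (by simpa using h4)
  rw [← norm_sq_torusMul_toLp, ← norm_sq_toLp, h1, h2, Submodule.norm_coe, Submodule.norm_coe, h3]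
  exact norm_sq_sum_smul_le hB h _ _

/-- Under a lower frame bound, multiplication by `F` is bounded below on analytic polynomials: by
Bessel's inequality, `∑ |⟨ζ^{α(k)} F, p⟩|² = ∑ |⟨ζ^{α(k)}, conj(F) p⟩|² ≤ ‖F p‖²`. -/
theorem integral_ge_of_lower_bound {A : ℝ}
    (hx : ∀ k, (x k : Lp ℂ 2 torusMeasure) =
      torusMul (ContinuousMap.toLp ⊤ torusMeasure ℂ (torusMonomial (primeExponents k))) F)
    (h : ∀ v : hardyTorus, A * ‖v‖ ^ 2 ≤ ∑' k, ‖inner ℂ (x k) v‖ ^ 2)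
    {p : C(InfTorus, ℂ)} (hp : p ∈ torusPolynomials) :
    A * ∫ ζ, ‖p ζ‖ ^ 2 ∂torusMeasure ≤ ∫ ζ, ‖F ζ‖ ^ 2 * ‖p ζ‖ ^ 2 ∂torusMeasure := by
  set u := torusMul (ContinuousMap.toLp ⊤ torusMeasure ℂ p) (star F) with hu
  have hstar : ∀ᵐ ζ ∂torusMeasure, (star F : Lp ℂ 2 torusMeasure) ζ = conj (F ζ) :=
    Lp.coeFn_star F
  have hun : ‖u‖ ^ 2 = ∫ ζ, ‖F ζ‖ ^ 2 * ‖p ζ‖ ^ 2 ∂torusMeasure := by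
    rw [hu, norm_sq_torusMul_toLp]
    refine integral_congr_ae ?_
    filter_upwards [hstar] with ζ hζ
    rw [hζ, RCLike.norm_conj]
  have hin : ∀ k, (inner ℂ (x k) (⟨_, toLp_mem_hardyTorus hp⟩ : hardyTorus) : ℂ) =
      inner ℂ (hardyBasis k : Lp ℂ 2 torusMeasure) u := fun k => by
    rw [Submodule.coe_inner, L2.inner_def, L2.inner_def, hx, hardyBasis_apply]
    refine integral_congr_ae ?_
    filter_upwards [hstar, coeFn_torusMul_toLp p (star F),
      coeFn_torusMul_toLp (torusMonomial (primeExponents k)) F,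
      ContinuousMap.coeFn_toLp (p := 2) (𝕜 := ℂ) torusMeasure p,
      ContinuousMap.coeFn_toLp (p := 2) (𝕜 := ℂ) torusMeasure (torusMonomial (primeExponents k))]
      with ζ h1 h2 h3 h4 h5
    simp only [hardyMonomial, RCLike.inner_apply, hu]
    rw [h2, h3, h4, h5, h1, map_mul]
    ring
  have ho : Orthonormal ℂ fun k => (hardyBasis k : Lp ℂ 2 torusMeasure) :=
    hardyBasis.orthonormal.comp_linearIsometry hardyTorus.subtypeₗᵢ
  have h1 := h ⟨_, toLp_mem_hardyTorus hp⟩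
  simp only [hin, Submodule.coe_norm, norm_sq_toLp] at h1
  exact (h1.trans (ho.tsum_inner_products_le u)).trans_eq hun

theorem integrable_norm_sq_mul_norm_sq (F : Lp ℂ 2 torusMeasure) (p : C(InfTorus, ℂ)) :
    Integrable (fun ζ => ‖F ζ‖ ^ 2 * ‖p ζ‖ ^ 2) torusMeasure := by
  refine (integrable_norm_sq
    (torusMul (ContinuousMap.toLp ⊤ torusMeasure ℂ p) F)).congr ?_
  filter_upwards [coeFn_torusMul_toLp p F] with ζ h
  rw [h, norm_mul, mul_pow, mul_comm]

theorem integrable_const_mul_norm_sq (c : ℝ) (p : C(InfTorus, ℂ)) :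
    Integrable (fun ζ => c * ‖p ζ‖ ^ 2) torusMeasure :=
  (by fun_prop : Continuous fun ζ => c * ‖p ζ‖ ^ 2).integrable_of_hasCompactSupport
    (HasCompactSupport.of_compactSpace _)

theorem ae_norm_sq_le {B : ℝ}
    (h : ∀ p ∈ torusPolynomials,
      ∫ ζ, ‖F ζ‖ ^ 2 * ‖p ζ‖ ^ 2 ∂torusMeasure ≤ B * ∫ ζ, ‖p ζ‖ ^ 2 ∂torusMeasure) :
    ∀ᵐ ζ ∂torusMeasure, ‖F ζ‖ ^ 2 ≤ B := by
  have h1 := ae_nonneg_of_integral_mul_norm_sq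
    ((integrable_const B).sub (integrable_norm_sq F)) fun p hp => by
      simp only [Pi.sub_apply, sub_mul]
      rw [integral_sub (integrable_const_mul_norm_sq B p) (integrable_norm_sq_mul_norm_sq F p),
        integral_const_mul, sub_nonneg]
      exact h p hp
  filter_upwards [h1] with ζ hζ
  simpa using hζ

theorem ae_le_norm_sq {A : ℝ}
    (h : ∀ p ∈ torusPolynomials,
      A * ∫ ζ, ‖p ζ‖ ^ 2 ∂torusMeasure ≤ ∫ ζ, ‖F ζ‖ ^ 2 * ‖p ζ‖ ^ 2 ∂torusMeasure) :
    ∀ᵐ ζ ∂torusMeasure, A ≤ ‖F ζ‖ ^ 2 := by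
  have h1 := ae_nonneg_of_integral_mul_norm_sq
    ((integrable_norm_sq F).sub (integrable_const A)) fun p hp => by
      simp only [Pi.sub_apply, sub_mul]
      rw [integral_sub (integrable_norm_sq_mul_norm_sq F p) (integrable_const_mul_norm_sq A p),
        integral_const_mul, sub_nonneg]
      exact h p hp
  filter_upwards [h1] with ζ hζ
  simpa using hζ

/-- If the multiples `ζ^{α(k)} F` form a frame, then `A ≤ |F|² ≤ B` almost everywhere, so that `F`
and `1 / F` are bounded. They also span a dense subspace, and multiplication by `1 / F` maps it to
polynomials; hence `1 / F` is the limit in `L²` of polynomials. -/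
theorem isInvertibleInHardyInfty_of_isFrame {F : hardyTorus}
    (hx : ∀ k, (x k : Lp ℂ 2 torusMeasure) =
      torusMul (ContinuousMap.toLp ⊤ torusMeasure ℂ (torusMonomial (primeExponents k))) F)
    (hf : IsFrame x) : IsInvertibleInHardyInfty F := by
  obtain ⟨A, B, hA, hB, h⟩ := hf
  have hupper := ae_norm_sq_le fun p hp =>
    integral_le_of_upper_bound hB.le hx (fun v => ⟨(h v).1, (h v).2.2⟩) hp
  have hlower := ae_le_norm_sq fun p hp => integral_ge_of_lower_bound hx (fun v => (h v).2.1) hp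
  have hne : ∀ᵐ ζ ∂torusMeasure, (F : Lp ℂ 2 torusMeasure) ζ ≠ 0 := by
    filter_upwards [hlower] with ζ hζ h0
    rw [h0] at hζ
    simp at hζ
    linarith
  have hFm := (Lp.aestronglyMeasurable (F : Lp ℂ 2 torusMeasure))
  have hinv : MemLp (fun ζ => ((F : Lp ℂ 2 torusMeasure) ζ)⁻¹) ⊤ torusMeasure := by
    refine memLp_top_of_bound hFm.aemeasurable.inv.aestronglyMeasurable (Real.sqrt A)⁻¹ ?_
    filter_upwards [hlower] with ζ hζ
    rw [norm_inv]
    exact inv_anti₀ (Real.sqrt_pos.2 hA) (Real.sqrt_le_left (norm_nonneg _) |>.2 hζ)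
  have hΦ := hinv.coeFn_toLp
  set Φ := hinv.toLp _ with hΦ_def
  have hΦx : ∀ k, torusMul Φ (x k) = hardyBasis k := fun k => by
    refine Lp.ext ?_
    rw [hx, hardyBasis_apply]
    filter_upwards [hne, hΦ, coeFn_torusMul Φ (torusMul (ContinuousMap.toLp ⊤ torusMeasure ℂ
        (torusMonomial (primeExponents k))) F),
      coeFn_torusMul_toLp (torusMonomial (primeExponents k)) (F : Lp ℂ 2 torusMeasure),
      ContinuousMap.coeFn_toLp (p := 2) (𝕜 := ℂ) torusMeasure (torusMonomial (primeExponents k))]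
      with ζ h0 h1 h2 h3 h4
    rw [h2, h1, h3, hardyMonomial, h4]
    field_simp
  have hdense : (Submodule.span ℂ (Set.range x)).topologicalClosure = ⊤ := by
    rw [Submodule.topologicalClosure_eq_top_iff, Submodule.eq_bot_iff]
    intro v hv
    have h0 : ∀ k, (inner ℂ (x k) v : ℂ) = 0 := fun k =>
      hv (x k) (Submodule.subset_span ⟨k, rfl⟩)
    have h1 := (h v).2.1
    simp only [h0, norm_zero, ne_eq, OfNat.ofNat_ne_zero, not_false_eq_true, zero_pow,
      tsum_zero] at h1
    have h2 : ‖v‖ ^ 2 ≤ 0 := by nlinarith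
    simpa using le_antisymm h2 (sq_nonneg _)
  have hmap : ∀ v : hardyTorus, torusMul Φ v ∈ hardyTorus := fun v => by
    have hle : (Submodule.span ℂ (Set.range x)).topologicalClosure ≤
        hardyTorus.comap ((torusMul Φ ∘L hardyTorus.subtypeL : hardyTorus →L[ℂ] _) :
          hardyTorus →ₗ[ℂ] Lp ℂ 2 torusMeasure) := by
      refine Submodule.topologicalClosure_minimal _ (Submodule.span_le.2 ?_) ?_
      · rintro _ ⟨k, rfl⟩
        change torusMul Φ (x k) ∈ hardyTorus
        rw [hΦx]
        exact (hardyBasis k).2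
      · exact (Submodule.isClosed_topologicalClosure _).preimage
          (torusMul Φ ∘L hardyTorus.subtypeL : hardyTorus →L[ℂ] _).continuous
    rw [hdense] at hle
    exact hle trivial
  -- `ζ^0 = 1`, so the image of this monomial is `1 / F` itself
  have hG : torusMul Φ (hardyMonomial 0) =ᵐ[torusMeasure]
      fun ζ => ((F : Lp ℂ 2 torusMeasure) ζ)⁻¹ := by
    filter_upwards [hΦ, coeFn_torusMul Φ (hardyMonomial 0),
      ContinuousMap.coeFn_toLp (p := 2) (𝕜 := ℂ) torusMeasure (torusMonomial 0)] with ζ h1 h2 h3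
    rw [h2, h1, hardyMonomial, h3, torusMonomial_zero]
    simp
  refine ⟨?_, ⟨_, hmap (hardyMonomial 0)⟩, hinv.ae_eq hG.symm, ?_⟩
  · refine memLp_top_of_bound hFm (Real.sqrt B) ?_
    filter_upwards [hupper] with ζ hζ
    exact Real.le_sqrt_of_sq_le hζ
  · filter_upwards [hG, hne] with ζ h1 h2
    rw [h1, mul_inv_cancel₀ h2]

/-- If `F` is invertible in `H^∞(𝕋^∞)`, then multiplication by its inverse is an isomorphism of
`H²(𝕋^∞)` that maps `ζ^{α(k)} F` to `ζ^{α(k)}`. -/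
theorem isRieszBasis_of_isInvertibleInHardyInfty {F : hardyTorus}
    (hx : ∀ k, (x k : Lp ℂ 2 torusMeasure) =
      torusMul (ContinuousMap.toLp ⊤ torusMeasure ℂ (torusMonomial (primeExponents k))) F)
    (hF : IsInvertibleInHardyInfty F) : IsRieszBasis x := by
  obtain ⟨hF, G, hG, hFG⟩ := hF
  have hΦ := MemLp.coeFn_toLp hF
  have hΓ := MemLp.coeFn_toLp hG
  set Φ := MemLp.toLp _ hF
  set Γ := MemLp.toLp _ hG
  have hΓΦ : ∀ g, torusMul Γ (torusMul Φ g) = g := fun g => by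
    refine Lp.ext ?_
    filter_upwards [hΦ, hΓ, hFG, coeFn_torusMul Γ (torusMul Φ g), coeFn_torusMul Φ g]
      with ζ h1 h2 h3 h4 h5
    rw [h4, h5, h1, h2, ← mul_assoc, mul_comm (G.1 ζ), h3, one_mul]
  have hΦΓ : ∀ g, torusMul Φ (torusMul Γ g) = g := fun g => by
    refine Lp.ext ?_
    filter_upwards [hΦ, hΓ, hFG, coeFn_torusMul Φ (torusMul Γ g), coeFn_torusMul Γ g]
      with ζ h1 h2 h3 h4 h5
    rw [h4, h5, h1, h2, ← mul_assoc, h3, one_mul]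
  set M : hardyTorus →L[ℂ] hardyTorus :=
    (torusMul Φ).restrict fun g hg => torusMul_mem F.2 hΦ hg
  set N : hardyTorus →L[ℂ] hardyTorus :=
    (torusMul Γ).restrict fun g hg => torusMul_mem G.2 hΓ hg
  refine ⟨ContinuousLinearEquiv.equivOfInverse N M (fun g => Subtype.ext (hΦΓ g))
    (fun g => Subtype.ext (hΓΦ g)), hardyBasis, fun k => Subtype.ext ?_⟩
  change torusMul Γ (x k) = hardyBasis k
  have h : (x k : Lp ℂ 2 torusMeasure) = torusMul Φ (hardyBasis k) := by
    refine Lp.ext ?_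
    rw [hx, hardyBasis_apply]
    filter_upwards [hΦ, coeFn_torusMul Φ (hardyMonomial (primeExponents k)),
      coeFn_torusMul_toLp (torusMonomial (primeExponents k)) (F : Lp ℂ 2 torusMeasure),
      ContinuousMap.coeFn_toLp (p := 2) (𝕜 := ℂ) torusMeasure (torusMonomial (primeExponents k))]
      with ζ h1 h2 h3 h4
    rw [h2, h1, h3, hardyMonomial, h4, mul_comm]
  rw [h, hΓΦ]

end MonomialMultiples

namespace DirichletType

variable {t : ℝ}

/-! ### Coefficients in the Dirichlet-type spaces -/

theorem coeff_powerDilation (f : DirichletType t) (k : ℕ+) :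
    (f.powerDilation k).coeff = Function.extend (fun n : ℕ+ => n * k) f.coeff 0 := by
  have hinj : Function.Injective fun n : ℕ+ => n * k := fun a b h => mul_right_cancel h
  refine coeff_unique _ fun z => ?_
  rw [← hinj.hasSum_iff (fun m hm => by
    rw [Function.extend_apply' _ _ _ (by simpa using hm)]; simp)]
  have hz : (f.powerDilation k) z = f (z ^ k) := rfl
  rw [hz]
  convert f.hasSum_coeff (z ^ k) using 2 with n
  simp only [Function.comp, hinj.extend_apply, Complex.UnitDisc.coe_pow, ← pow_mul]
  rw [PNat.mul_coe, mul_comm (n : ℕ)]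

theorem coeff_powerDilation_mul (f : DirichletType t) (n k : ℕ+) :
    (f.powerDilation k).coeff (n * k) = f.coeff n := by
  have hinj : Function.Injective fun n : ℕ+ => n * k := fun a b h => mul_right_cancel h
  rw [coeff_powerDilation]
  exact hinj.extend_apply f.coeff 0 n

theorem coeff_powerDilation_of_not_dvd (f : DirichletType t) {m k : ℕ+} (h : ¬ k ∣ m) :
    (f.powerDilation k).coeff m = 0 := by
  rw [coeff_powerDilation, Function.extend_apply']
  · rfl
  · rintro ⟨n, rfl⟩
    exact h (dvd_mul_left k n)

/-- The monomial `zᵐ`, an element of `𝒟ₜ`. -/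
def monomial (t : ℝ) (m : ℕ+) : DirichletType t :=
  ⟨fun z => (z : ℂ) ^ (m : ℕ), Pi.single m 1, fun z => by
    convert hasSum_single m fun n hn => ?_ using 1
    · simp
    · simp [hn], summable_of_ne_finset_zero (s := {m}) fun n hn => by
      simp [Finset.notMem_singleton.1 hn]⟩

theorem coeff_monomial (m : ℕ+) : (monomial t m).coeff = Pi.single m 1 := by
  refine coeff_unique _ fun z => ?_
  have h : (monomial t m) z = (z : ℂ) ^ (m : ℕ) := rfl
  rw [h]
  convert hasSum_single m fun n hn => ?_ using 1
  · simp
  · simp [hn]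

theorem norm_sq_monomial (m : ℕ+) : ‖monomial t m‖ ^ 2 = ((m : ℝ) + 1) ^ t := by
  rw [norm_sq, coeff_monomial, tsum_eq_single m fun n hn => by simp [hn]]
  simp

theorem inner_monomial (f : DirichletType t) (m : ℕ+) :
    inner ℂ f (monomial t m) = conj (f.coeff m) * (((m : ℝ) + 1) ^ t : ℝ) := by
  change innerSeries f (monomial t m) = _
  rw [innerSeries, coeff_monomial, tsum_eq_single m fun n hn => by simp [hn]]
  simp

theorem norm_sq_inner_monomial (f : DirichletType t) (m : ℕ+) :
    ‖(inner ℂ f (monomial t m) : ℂ)‖ ^ 2 = ‖f.coeff m‖ ^ 2 * (((m : ℝ) + 1) ^ t) ^ 2 := by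
  rw [inner_monomial, norm_mul, RCLike.norm_conj, mul_pow, Complex.norm_real, Real.norm_eq_abs,
    sq_abs]

/-! ### Absence of frames of dilations for nonzero parameter -/

/-- For `t > 0`, the upper frame bound, tested on `zᵐ` for the multiples `m = dj` of `d`, gives
`|a_d|² (dj + 1)ᵗ ≤ B` for all `j`, so that `f = 0`. -/
theorem not_isFrame_powerDilation_of_pos (ht : 0 < t) (f : DirichletType t) :
    ¬ IsFrame fun k : ℕ+ => f.powerDilation k := by
  rintro ⟨A, B, hA, hB, h⟩
  have h0 : ∀ d, f.coeff d = 0 := by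
    intro d
    by_contra hd
    have hpos : 0 < ‖f.coeff d‖ ^ 2 := by positivity
    have hlim : Filter.Tendsto (fun j : ℕ => ((j : ℝ) + 1 + 1) ^ t) Filter.atTop Filter.atTop :=
      (tendsto_rpow_atTop ht).comp (Filter.tendsto_atTop_add_const_right _ _
        (Filter.tendsto_atTop_add_const_right _ _ tendsto_natCast_atTop_atTop))
    obtain ⟨j, hj⟩ := (hlim.eventually_gt_atTop (B / ‖f.coeff d‖ ^ 2)).exists
    set k : ℕ+ := j.succPNat with hk
    have hkj : ((k : ℕ) : ℝ) = j + 1 := by rw [hk]; simp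
    have h1 := (h (monomial t (d * k))).1.le_tsum k fun _ _ => sq_nonneg _
    have h2 := h1.trans (h (monomial t (d * k))).2.2
    rw [norm_sq_inner_monomial, coeff_powerDilation_mul, norm_sq_monomial, sq (_ ^ t),
      ← mul_assoc] at h2
    have h3 := le_of_mul_le_mul_right h2 (weight_pos t (d * k))
    have h4 : ((j : ℝ) + 1 + 1) ^ t ≤ (((d * k : ℕ+) : ℝ) + 1) ^ t := by
      have hd1 : (1 : ℝ) ≤ d := by exact_mod_cast d.2
      push_cast
      rw [hkj]
      gcongr
      nlinarith
    rw [div_lt_iff₀ hpos] at hj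
    nlinarith
  have h1 := (h (monomial t 1)).2.1
  have h3 : ∀ k : ℕ+, ‖(inner ℂ (f.powerDilation k) (monomial t 1) : ℂ)‖ ^ 2 = 0 := fun k => by
    have hk : (f.powerDilation k).coeff 1 = 0 := by
      by_cases hk : k ∣ 1
      · obtain ⟨n, hn⟩ := hk
        rw [hn, mul_comm, coeff_powerDilation_mul, h0]
      · exact f.coeff_powerDilation_of_not_dvd hk
    rw [norm_sq_inner_monomial, hk]
    simp
  simp only [h3, tsum_zero, norm_sq_monomial] at h1
  have := mul_pos hA (weight_pos t 1)
  linarith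

/-- For `t < 0`, the lower frame bound, tested on `zᵖ` for a prime `p`, gives
`A ≤ (|a_p|² + |a_1|²) (p + 1)ᵗ`, which tends to `0` as `p → ∞`. -/
theorem not_isFrame_powerDilation_of_neg (ht : t < 0) (f : DirichletType t) :
    ¬ IsFrame fun k : ℕ+ => f.powerDilation k := by
  rintro ⟨A, B, hA, hB, h⟩
  have hprime : ∀ p : ℕ+, (p : ℕ).Prime →
      A ≤ ‖f.coeff p‖ ^ 2 * ((p : ℝ) + 1) ^ t + ‖f.coeff 1‖ ^ 2 * ((p : ℝ) + 1) ^ t := by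
    intro p hp
    have hp1 : (1 : ℕ+) ≠ p := fun h => hp.one_lt.ne (congrArg PNat.val h)
    have h1 := (h (monomial t p)).2.1
    rw [tsum_eq_sum (s := {1, p}), Finset.sum_pair hp1, norm_sq_monomial, norm_sq_inner_monomial,
      norm_sq_inner_monomial] at h1
    · have ha : (f.powerDilation 1).coeff p = f.coeff p := by
        simpa using f.coeff_powerDilation_mul p 1
      have hb : (f.powerDilation p).coeff p = f.coeff 1 := by
        simpa using f.coeff_powerDilation_mul 1 p
      rw [ha, hb] at h1
      refine le_of_mul_le_mul_right (h1.trans_eq ?_) (weight_pos t p)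
      ring
    · intro k hk
      rw [norm_sq_inner_monomial, coeff_powerDilation_of_not_dvd]
      · simp
      · intro hdvd
        apply hk
        rcases (Nat.dvd_prime hp).1 (PNat.dvd_iff.1 hdvd) with h1 | h1
        · simp [PNat.eq (n := 1) h1]
        · simp [PNat.eq h1]
  have hlim1 : Filter.Tendsto (fun n : ℕ+ => ‖f.coeff n‖ ^ 2 * ((n : ℝ) + 1) ^ t)
      Filter.cofinite (nhds 0) := f.summable_coeff.tendsto_cofinite_zero
  have hlim2 : Filter.Tendsto (fun n : ℕ+ => ‖f.coeff 1‖ ^ 2 * ((n : ℝ) + 1) ^ t)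
      Filter.cofinite (nhds 0) := by
    have h1 : Filter.Tendsto (fun n : ℕ => ((n : ℝ) + 1) ^ t) Filter.atTop (nhds 0) := by
      have := (tendsto_rpow_neg_atTop (neg_pos.2 ht)).comp
        (Filter.tendsto_atTop_add_const_right _ 1 (tendsto_natCast_atTop_atTop (R := ℝ)))
      simpa [Function.comp_def] using this
    rw [← Nat.cofinite_eq_atTop] at h1
    simpa using (h1.comp PNat.coe_injective.tendsto_cofinite).const_mul (‖f.coeff 1‖ ^ 2)
  have hlim := (hlim1.add hlim2).eventually_lt_const (u := A) (by simpa using hA)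
  have hinf : {p : ℕ+ | (p : ℕ).Prime}.Infinite := by
    refine Set.Infinite.of_image PNat.val (Nat.infinite_setOfPred_prime.mono fun p hp => ?_)
    exact ⟨⟨p, hp.pos⟩, hp, rfl⟩
  obtain ⟨p, hp, hlt⟩ := (hinf.frequently_cofinite.and_eventually hlim).exists
  exact (hprime p hp).not_gt hlt

end DirichletType

/-! ### The Bohr transform as a unitary operator -/

theorem hardyBasis_repr_bohr (f : HardyZero) (n : ℕ+) : hardyBasis.repr (bohr f) n = f.coeff n := by
  have h := (hasSum_bohr f).mapL (innerSL ℂ (hardyBasis n))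
  have h1 : ∀ k, innerSL ℂ (hardyBasis n) (f.coeff k • hardyMonomial (primeExponents k)) =
      if k = n then f.coeff n else 0 := fun k => by
    rw [← hardyBasis_apply, map_smul, innerSL_apply_apply, smul_eq_mul,
      orthonormal_iff_ite.1 hardyBasis.orthonormal]
    by_cases hkn : n = k
    · simp [hkn]
    · simp [hkn, Ne.symm hkn]
  simp only [h1] at h
  rw [HilbertBasis.repr_apply_apply]
  exact h.unique (hasSum_ite_eq n _)

/-- The Bohr transform is a unitary operator from `H₀²(𝔻)` onto `H²(𝕋^∞)`. -/
def bohrEquiv : HardyZero ≃ₗᵢ[ℂ] hardyTorus :=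
  LinearIsometryEquiv.ofSurjective
    { toFun := bohr
      map_add' := fun f g => hardyBasis.repr.injective <| lp.ext <| funext fun n => by
        simp [hardyBasis_repr_bohr, DirichletType.coeff_add]
      map_smul' := fun c f => hardyBasis.repr.injective <| lp.ext <| funext fun n => by
        simp [hardyBasis_repr_bohr, DirichletType.coeff_smul]
      norm_map' := fun f => by
        change ‖bohr f‖ = ‖f‖
        have h1 : ‖hardyBasis.repr (bohr f)‖ ^ 2 = ‖f‖ ^ 2 := by
          have h2 := lp.norm_rpow_eq_tsum (p := 2) (by norm_num) (hardyBasis.repr (bohr f))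
          simp only [hardyBasis_repr_bohr] at h2
          rw [DirichletType.norm_sq]
          simpa using h2
        rw [LinearIsometryEquiv.norm_map] at h1
        exact (sq_eq_sq₀ (norm_nonneg _) (norm_nonneg _)).1 h1 } (by
      intro g
      have hs : Summable fun n => ‖hardyBasis.repr g n‖ ^ 2 := by
        simpa using (lp.memℓp (hardyBasis.repr g)).summable (by norm_num)
      have hconv : ∀ z : 𝔻, Summable fun n : ℕ+ => hardyBasis.repr g n * (z : ℂ) ^ (n : ℕ) := by
        intro z
        have hz : Summable fun n : ℕ+ => ‖(z : ℂ) ^ (n : ℕ)‖ ^ 2 := by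
          have h1 : ‖(z : ℂ)‖ ^ 2 < 1 := by
            have := z.norm_lt_one
            nlinarith [norm_nonneg (z : ℂ)]
          have h2 := (summable_geometric_of_lt_one (sq_nonneg _) h1).comp_injective
            PNat.coe_injective
          refine h2.congr fun n => ?_
          simp only [Function.comp, norm_pow, ← pow_mul, mul_comm]
        refine Summable.of_norm_bounded (hs.add hz) fun n => ?_
        rw [norm_mul]
        nlinarith [sq_nonneg (‖hardyBasis.repr g n‖ - ‖(z : ℂ) ^ (n : ℕ)‖),
          sq_nonneg ‖hardyBasis.repr g n‖, sq_nonneg ‖(z : ℂ) ^ (n : ℕ)‖]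
      let f : HardyZero := ⟨fun z => ∑' n : ℕ+, hardyBasis.repr g n * (z : ℂ) ^ (n : ℕ),
        hardyBasis.repr g, fun z => (hconv z).hasSum, by simpa using hs⟩
      have hf : f.coeff = hardyBasis.repr g := f.coeff_unique fun z => (hconv z).hasSum
      refine ⟨f, hardyBasis.repr.injective <| lp.ext <| funext fun n => ?_⟩
      exact (hardyBasis_repr_bohr f n).trans (congrFun hf n))

theorem bohrEquiv_apply (f : HardyZero) : bohrEquiv f = bohr f := rfl

/-- The Bohr transform turns the dilation `f(z) ↦ f(zᵏ)` into multiplication by `ζ^{α(k)}`. -/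
theorem bohr_powerDilation (f : HardyZero) (k : ℕ+) :
    (bohr (f.powerDilation k) : Lp ℂ 2 torusMeasure) =
      torusMul (ContinuousMap.toLp ⊤ torusMeasure ℂ (torusMonomial (primeExponents k)))
        (bohr f) := by
  have hinj : Function.Injective fun n : ℕ+ => n * k := fun a b h => mul_right_cancel h
  have h1 := ((hasSum_bohr f).mapL hardyTorus.subtypeL).mapL
    (torusMul (ContinuousMap.toLp ⊤ torusMeasure ℂ (torusMonomial (primeExponents k))))
  have h2 := (hasSum_bohr (f.powerDilation k)).mapL hardyTorus.subtypeL
  rw [← hinj.hasSum_iff] at h2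
  · refine h2.unique (h1.congr_fun fun n => ?_)
    simp only [Function.comp, DirichletType.coeff_powerDilation_mul, map_smul]
    congr 1
    change ContinuousMap.toLp 2 torusMeasure ℂ _ = torusMul _ (ContinuousMap.toLp 2 torusMeasure ℂ _)
    rw [torusMul_toLp_toLp, primeExponents_mul, torusMonomial_add, mul_comm]
  · intro m hm
    rw [DirichletType.coeff_powerDilation_of_not_dvd]
    · simp
    · rintro ⟨n, rfl⟩
      exact hm ⟨n, mul_comm _ _⟩

end

theorem theorem3p3 :
    (∀ f : HardyZero,
      (IsFrame (fun k : ℕ+ => f.powerDilation k) ↔ IsRieszBasis (fun k : ℕ+ => f.powerDilation k)) ∧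
      (IsRieszBasis (fun k : ℕ+ => f.powerDilation k) ↔ IsInvertibleInHardyInfty (bohr f))) ∧
    (∀ t : ℝ, t ≠ 0 → ∀ f : DirichletType t, ¬ IsFrame (fun k : ℕ+ => f.powerDilation k)) := by
  refine ⟨fun f => ?_, fun t ht f => ?_⟩
  · have hx := bohr_powerDilation f
    have hinv : IsFrame (fun k : ℕ+ => f.powerDilation k) → IsInvertibleInHardyInfty (bohr f) :=
      fun h => isInvertibleInHardyInfty_of_isFrame hx (h.map bohrEquiv)
    have hriesz : IsInvertibleInHardyInfty (bohr f) →
        IsRieszBasis (fun k : ℕ+ => f.powerDilation k) := fun h => by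
      simpa only [← bohrEquiv_apply, LinearIsometryEquiv.symm_apply_apply] using
        (isRieszBasis_of_isInvertibleInHardyInfty hx h).map bohrEquiv.symm
    have hframe : IsRieszBasis (fun k : ℕ+ => f.powerDilation k) →
        IsFrame (fun k : ℕ+ => f.powerDilation k) := fun h => by
      simpa only [LinearIsometryEquiv.symm_apply_apply] using
        (h.map bohrEquiv).isFrame.map bohrEquiv.symm
    exact ⟨⟨hriesz ∘ hinv, hframe⟩, ⟨hinv ∘ hframe, hriesz⟩⟩
  · rcases ht.lt_or_gt with ht | ht
    · exact f.not_isFrame_powerDilation_of_neg ht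
    · exact f.not_isFrame_powerDilation_of_pos ht
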